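/- Let $G$ be a finite simple planar graph with chromatic number $\chi(G)=3$. Then $G$ is $\{1,3\}$-choosable. Here, for a partition $\lambda=\{k_1,\dots,k_q\}$ of a positive integer $k$ (a finite multiset of positive integers with sum $k$), a $\lambda$-assignment of $G$ is a map $L$ which assigns to each vertex $v$ a set $L(v)$ of exactly $k$ colours, such that the set $\bigcup_{v\in V(G)}L(v)$ can be partitioned into sets $C_1,\dots,C_q$ with $|L(v)\cap C_i|=k_i$ for every vertex $v$ and every $1\le i\le q$. The graph $G$ is $\lambda$-choosable if for every $\lambda$-assignment $L$ there is a proper colouring $f$ of $G$ with $f(v)\in L(v)$ for every vertex $v$. A finite graph is planar if it can be drawn in the plane without crossings, the edges being simple polygonal arcs. -/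

import Mathlib

universe u w

namespace SimpleGraph

/-! ### Assignments and choosability for a partition -/

section Choosability

variable {V : Type u} {α : Type w}

/-- A proper `L`-colouring: adjacent vertices get distinct colours, and every vertex `v` gets a
colour from its list `L v`. -/
def IsListColoring (G : SimpleGraph V) (L : V → Finset α) (f : V → α) : Prop :=
  (∀ v, f v ∈ L v) ∧ ∀ v w, G.Adj v w → f v ≠ f w

/-- `G` is `L`-colourable. -/
def ListColorable (G : SimpleGraph V) (L : V → Finset α) : Prop :=
  ∃ f : V → α, G.IsListColoring L f

/-- `L` is a `lam`-assignment, for a partition `lam = {k 0, …, k (q-1)}` of `n`: all lists have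
`n` colours, and the set of all colours used in the lists is partitioned into colour groups
`C 0, …, C (q-1)` such that every list has exactly `k i` colours in `C i`. -/
def IsPartitionAssignment {n : ℕ} (lam : n.Partition) (L : V → Finset α) : Prop :=
  (∀ v, (L v).card = n) ∧
  ∃ (q : ℕ) (k : Fin q → ℕ) (C : Fin q → Set α),
    Multiset.map k Finset.univ.val = lam.parts ∧
    (⋃ i, C i) = (⋃ v, (L v : Set α)) ∧
    (∀ i j, i ≠ j → Disjoint (C i) (C j)) ∧
    ∀ v i, ((L v : Set α) ∩ C i).ncard = k i

/-- `G` is `lam`-choosable: it is `L`-colourable for every `lam`-assignment `L`, with colours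
from an arbitrary set. -/
def PartitionChoosable (G : SimpleGraph V) {n : ℕ} (lam : n.Partition) : Prop :=
  ∀ (α : Type w) (L : V → Finset α), IsPartitionAssignment lam L → G.ListColorable L

end Choosability

/-- The partition `{1, 3}` of `4`. -/
def partitionOneThree : Nat.Partition 4 where
  parts := {1, 3}
  parts_pos := by simp
  parts_sum := by simp

/-! ### Planar graphs -/

/-- A simple polygonal arc in the plane `ℝ × ℝ`: distinct corners `pt 0, …, pt n`, consecutive
ones joined by straight segments. Two different segments meet only in a common corner, and only
if they are consecutive (for non-consecutive segments the right-hand side of `simple` is empty,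
because the corners are distinct). -/
structure PolygonalArc where
  n : ℕ
  pt : Fin (n + 1) → ℝ × ℝ
  pt_injective : Function.Injective pt
  simple : ∀ i j : Fin n, i < j →
    segment ℝ (pt i.castSucc) (pt i.succ) ∩ segment ℝ (pt j.castSucc) (pt j.succ) ⊆
      {pt i.succ} ∩ {pt j.castSucc}

namespace PolygonalArc

/-- The first end of the arc. -/
def source (A : PolygonalArc) : ℝ × ℝ := A.pt 0

/-- The last end of the arc. -/
def target (A : PolygonalArc) : ℝ × ℝ := A.pt (Fin.last A.n)

/-- The set of points of the arc. -/
def carrier (A : PolygonalArc) : Set (ℝ × ℝ) :=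
  ⋃ i : Fin A.n, segment ℝ (A.pt i.castSucc) (A.pt i.succ)

end PolygonalArc

/-- A drawing of `G` in the plane without crossings: distinct vertices are distinct points, every
edge is a simple polygonal arc between its two ends, an edge contains no vertices other than its
ends, and two different edges have no common points other than common ends. -/
structure PlaneDrawing {V : Type u} (G : SimpleGraph V) where
  pos : V → ℝ × ℝ
  pos_injective : Function.Injective pos
  arc : G.edgeSet → PolygonalArc
  ends : ∀ e : G.edgeSet, s((arc e).source, (arc e).target) = Sym2.map pos (e : Sym2 V)
  vertex_on_arc : ∀ (e : G.edgeSet) (v : V), pos v ∈ (arc e).carrier → v ∈ (e : Sym2 V)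
  arc_inter : ∀ e f : G.edgeSet, e ≠ f →
    (arc e).carrier ∩ (arc f).carrier ⊆ pos '' {v | v ∈ (e : Sym2 V) ∧ v ∈ (f : Sym2 V)}

/-- `G` is planar: it can be drawn in the plane without crossings. -/
def IsPlanar {V : Type u} (G : SimpleGraph V) : Prop :=
  Nonempty G.PlaneDrawing

end SimpleGraph

namespace SimpleGraph

open Filter Topology Complex

/-! ### Argument sums of weighted segments -/

/-! Fix a proper 3-colouring. One class takes its colours from the group that meets every list once;
the other two classes span a bipartite planar graph, coloured from the group that meets every list
three times. The groups are disjoint, so the two colourings never conflict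
(`partitionChoosable_oneThree_of_sparse`). What is needed is that bipartite planar graphs are
3-choosable.

This follows from sparseness: a bipartite planar graph with `m` edges and `n` non-isolated vertices
has `m ≤ 2n`, and so has each subgraph. By Hall's theorem the edges can be oriented with out-degrees
at most 2 (`exists_two_orientation`). Bipartite digraphs have kernels, and colouring one kernel
after another succeeds when lists are longer than out-degrees
(`exists_listColoring_of_outdegree_lt`).

The edge bound uses winding numbers in place of faces and Euler's formula. For an integer cycle on
the edges, `argSum` divided by 2π is an integer away from corners, locally constant off the drawing,
and jumps by the weight of an edge across that edge. Directed edges whose left sides carry the same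
value for every cycle form classes, which play the role of faces. A cycle is determined by its
values on the `q` classes, so the cycle space has rank at most `q` and `m ≤ n + q`. Turning
clockwise to the next edge at each vertex stays in a class (`exists_next_side`, `exists_next_dart`);
in a bipartite graph without pendant edges, four steps of this walk give four distinct directed
edges. Hence `4q ≤ 2m`, and `m ≤ 2n`. Pendant edges are removed by induction. -/

theorem div_mem_slitPlane_of_notMem_segment {a b p : ℂ} (h : p ∉ segment ℝ a b) :
    (b - p) / (a - p) ∈ slitPlane := by
  by_contra hn
  have ha : a - p ≠ 0 := fun h0 => h (by
    rw [← sub_eq_zero.1 h0]; exact left_mem_segment ℝ _ _)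
  rw [mem_slitPlane_iff, not_or, not_lt, not_ne_iff] at hn
  obtain ⟨hre, him⟩ := hn
  set k := ((b - p) / (a - p)).re with hk
  have hz : (b - p) / (a - p) = (k : ℂ) := Complex.ext (by simp [hk]) (by simp [him])
  rw [div_eq_iff ha] at hz
  apply h
  have hpos : 0 < 1 - k := by linarith
  -- Solving `b - p = k * (a - p)` for `p` gives these weights; they are nonnegative because `k ≤
  -- 0`.
  refine ⟨-k / (1 - k), 1 / (1 - k), by apply div_nonneg <;> linarith, by positivity,
    by field_simp; ring, ?_⟩
  have hc : (1 - k : ℂ) ≠ 0 := by exact_mod_cast hpos.ne'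
  simp only [real_smul]
  push_cast
  field_simp
  linear_combination hz

/-- From an inner point the two ends lie in opposite directions. The quotient thus sits on the
branch cut of `arg`, which is the source of the jump across a segment. -/
theorem arg_div_of_mem_openSegment {a b p : ℂ} (hab : a ≠ b) (h : p ∈ openSegment ℝ a b) :
    ((b - p) / (a - p)).re < 0 ∧ ((b - p) / (a - p)).im = 0 := by
  obtain ⟨x, y, hx, hy, hxy, rfl⟩ := h
  have e : (b - (x • a + y • b)) / (a - (x • a + y • b)) = ((-(x / y) : ℝ) : ℂ) := by
    have hx' : (x : ℂ) = 1 - y := by rw [eq_sub_of_add_eq hxy]; push_cast; rfl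
    have hy' : (y : ℂ) ≠ 0 := by exact_mod_cast hy.ne'
    have h1 : a - (x • a + y • b) = y * (a - b) := by
      simp only [real_smul, hx']; ring
    have h2 : b - (x • a + y • b) = -(x * (a - b)) := by
      simp only [real_smul, hx']; ring
    rw [h1, h2]
    have := sub_ne_zero.2 hab
    push_cast
    field_simp
  rw [e]
  exact ⟨by rw [ofReal_re]; have := div_pos hx hy; linarith, ofReal_im _⟩

/-- A family of non-degenerate segments in the plane which meet only in common ends. -/
structure SegmentSystem (S : Type*) where
  a : S → ℂ
  b : S → ℂ
  ne : ∀ s, a s ≠ b s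
  inter : ∀ s t, s ≠ t → ∀ p, p ∈ segment ℝ (a s) (b s) → p ∈ segment ℝ (a t) (b t) →
    (p = a s ∨ p = b s) ∧ (p = a t ∨ p = b t)

namespace SegmentSystem

variable {S : Type*} (T : SegmentSystem S)

/-- The weighted sum of the angles under which the segments are seen from `p`. -/
noncomputable def argSum [Fintype S] (c : S → ℤ) (p : ℂ) : ℝ :=
  ∑ s, (c s : ℝ) * arg ((T.b s - p) / (T.a s - p))

/-- The weights form a cycle: from every point that is no end of a segment, the total angle is an
integer multiple of `2 * π`. -/
def IsCycle [Fintype S] (c : S → ℤ) : Prop :=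
  ∀ p, (∀ s, p ≠ T.a s ∧ p ≠ T.b s) → ∃ n : ℤ, T.argSum c p = 2 * Real.pi * n

/-- The first end of a directed segment. -/
def tail (d : S × Bool) : ℂ := if d.2 then T.a d.1 else T.b d.1

/-- The last end of a directed segment. -/
def head (d : S × Bool) : ℂ := if d.2 then T.b d.1 else T.a d.1

/-- The value of `argSum` next to a directed segment, on its left. -/
noncomputable def side [Fintype S] (c : S → ℤ) (d : S × Bool) : ℝ :=
  T.argSum c (midpoint ℝ (T.a d.1) (T.b d.1)) - if d.2 then 0 else 2 * Real.pi * c d.1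

variable {T}

theorem ends_ne_of_mem_openSegment {s : S} {p : ℂ}
    (h : p ∈ openSegment ℝ (T.a s) (T.b s)) (t : S) : p ≠ T.a t ∧ p ≠ T.b t := by
  have hs : p ≠ T.a s ∧ p ≠ T.b s := by
    constructor
    · rintro rfl
      exact T.ne s (left_mem_openSegment_iff.1 h)
    · rintro rfl
      exact T.ne s (right_mem_openSegment_iff.1 h)
  by_cases hst : s = t
  · exact hst ▸ hs
  · have hp := openSegment_subset_segment ℝ _ _ h
    refine ⟨?_, ?_⟩ <;> rintro rfl
    · rcases (T.inter s t hst _ hp (left_mem_segment ℝ _ _)).1 with h | h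
      exacts [hs.1 h, hs.2 h]
    · rcases (T.inter s t hst _ hp (right_mem_segment ℝ _ _)).1 with h | h
      exacts [hs.1 h, hs.2 h]

theorem notMem_segment_of_mem_openSegment {s t : S} {p : ℂ} (hst : s ≠ t)
    (h : p ∈ openSegment ℝ (T.a s) (T.b s)) : p ∉ segment ℝ (T.a t) (T.b t) := fun hp => by
  rcases (T.inter s t hst p (openSegment_subset_segment ℝ _ _ h) hp).1 with h' | h'
  exacts [(ends_ne_of_mem_openSegment h s).1 h', (ends_ne_of_mem_openSegment h s).2 h']

theorem continuousAt_arg_div {a b p : ℂ} (h : p ∉ segment ℝ a b) :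
    ContinuousAt (fun q => arg ((b - q) / (a - q))) p := by
  have ha : a - p ≠ 0 := fun h0 => h (by
    rw [← sub_eq_zero.1 h0]; exact left_mem_segment ℝ _ _)
  have hdiv : ContinuousAt (fun q => (b - q) / (a - q)) p :=
    ContinuousAt.div (by fun_prop) (by fun_prop) ha
  exact ContinuousAt.comp (f := fun q => (b - q) / (a - q))
    (continuousAt_arg (div_mem_slitPlane_of_notMem_segment h)) hdiv

variable [Fintype S]

theorem continuousAt_argSum (c : S → ℤ) {p : ℂ} (h : ∀ s, p ∉ segment ℝ (T.a s) (T.b s)) :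
    ContinuousAt (T.argSum c) p :=
  tendsto_finsetSum _ fun s _ => (continuousAt_arg_div (h s)).const_mul (c s : ℝ)

/-- Serves to show that `argSum` of a cycle is constant on preconnected sets where it is continuous.
-/
theorem isDiscrete_range_two_pi_mul_int :
    IsDiscrete (Set.range fun n : ℤ => 2 * Real.pi * (n : ℝ)) := by
  have h : Set.range (fun n : ℤ => 2 * Real.pi * (n : ℝ)) =
      (AddSubgroup.zmultiples (2 * Real.pi) : Set ℝ) := by
    ext x
    simp [AddSubgroup.mem_zmultiples_iff, mul_comm]
  rw [h]
  exact ⟨inferInstanceAs (DiscreteTopology (AddSubgroup.zmultiples (2 * Real.pi)))⟩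

theorem eq_of_abs_sub_lt_two_pi {x y : ℝ} (hx : ∃ n : ℤ, x = 2 * Real.pi * n)
    (hy : ∃ n : ℤ, y = 2 * Real.pi * n) (h : |x - y| < 2 * Real.pi) : x = y := by
  obtain ⟨n, rfl⟩ := hx
  obtain ⟨m, rfl⟩ := hy
  rw [← mul_sub, abs_mul, abs_of_pos Real.two_pi_pos] at h
  have h1 : |(n : ℝ) - m| < 1 := by
    by_contra hc
    have := mul_le_mul_of_nonneg_left (not_lt.1 hc) Real.two_pi_pos.le
    linarith
  have h2 : |n - m| < 1 := by exact_mod_cast h1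
  rw [Int.abs_lt_one_iff, sub_eq_zero] at h2
  rw [h2]

/-- The value of `argSum` is the same at all inner points of a segment. -/
theorem argSum_eq_midpoint {c : S → ℤ} (hc : T.IsCycle c) {s : S} {p : ℂ}
    (h : p ∈ openSegment ℝ (T.a s) (T.b s)) :
    T.argSum c p = T.argSum c (midpoint ℝ (T.a s) (T.b s)) := by
  have hmid : midpoint ℝ (T.a s) (T.b s) ∈ openSegment ℝ (T.a s) (T.b s) :=
    midpoint_mem_openSegment _ _
  have hpre := (convex_openSegment (𝕜 := ℝ) (T.a s) (T.b s)).isPreconnected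
  refine hpre.constant_of_mapsTo isDiscrete_range_two_pi_mul_int ?_ ?_ h hmid
  · refine continuousOn_finsetSum _ fun t _ => ?_
    by_cases hst : s = t
    · subst hst
      -- `arg` is discontinuous in the plane here, but along the segment itself this term is
      -- constantly `c s * π`.
      refine (continuousOn_const (c := (c s : ℝ) * Real.pi)).congr fun q hq => ?_
      obtain ⟨h1, h2⟩ := arg_div_of_mem_openSegment (T.ne s) hq
      simp only [arg_eq_pi_iff.2 ⟨h1, h2⟩]
    · exact fun q hq => ((continuousAt_arg_div
        (notMem_segment_of_mem_openSegment hst hq)).const_mul _).continuousWithinAt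
  · intro q hq
    obtain ⟨n, hn⟩ := hc q fun t => ends_ne_of_mem_openSegment hq t
    exact ⟨n, hn.symm⟩

theorem argSum_eq_erase [DecidableEq S] (c : S → ℤ) (s : S) (q : ℂ) : T.argSum c q =
    c s * arg ((T.b s - q) / (T.a s - q)) +
      ∑ t ∈ Finset.univ.erase s, (c t : ℝ) * arg ((T.b t - q) / (T.a t - q)) :=
  (Finset.add_sum_erase _ _ (Finset.mem_univ s)).symm

/-- Approaching from the left, the angle of the segment itself tends to `π` or `-π` according to its
direction, while all other terms are continuous. Nearby values and the limit are multiples of `2 *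
π`, so being close forces equality. -/
theorem side_eventually {c : S → ℤ} (hc : T.IsCycle c) (d : S × Bool) {p : ℂ}
    (h : p ∈ openSegment ℝ (T.a d.1) (T.b d.1)) :
    ∀ᶠ q in 𝓝 p, 0 < ((T.head d - q) / (T.tail d - q)).im → T.argSum c q = T.side c d := by
  classical
  obtain ⟨s, β⟩ := d
  simp only at h
  have hends := ends_ne_of_mem_openSegment h
  obtain ⟨hre, him⟩ := arg_div_of_mem_openSegment (T.ne s) h
  have hrest : Tendsto (fun q => ∑ t ∈ Finset.univ.erase s,
      (c t : ℝ) * arg ((T.b t - q) / (T.a t - q))) (𝓝 p)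
      (𝓝 (∑ t ∈ Finset.univ.erase s, (c t : ℝ) * arg ((T.b t - p) / (T.a t - p)))) :=
    tendsto_finsetSum _ fun t ht => (continuousAt_arg_div (notMem_segment_of_mem_openSegment
      (Finset.ne_of_mem_erase ht).symm h)).const_mul (c t : ℝ)
  have hdiv : ContinuousAt (fun q => (T.b s - q) / (T.a s - q)) p :=
    ContinuousAt.div (by fun_prop) (by fun_prop) (sub_ne_zero.2 (hends s).1.symm)
  have hint : ∀ᶠ q in 𝓝 p, ∃ n : ℤ, T.argSum c q = 2 * Real.pi * n := by
    have : ∀ᶠ q in 𝓝 p, ∀ s, q ≠ T.a s ∧ q ≠ T.b s := by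
      rw [eventually_all]
      exact fun t => (eventually_ne_nhds (hends t).1).and (eventually_ne_nhds (hends t).2)
    exact this.mono fun q hq => hc q hq
  have hside : T.side c (s, β) = c s * (if β then Real.pi else -Real.pi) +
      ∑ t ∈ Finset.univ.erase s, (c t : ℝ) * arg ((T.b t - p) / (T.a t - p)) := by
    rw [side, ← argSum_eq_midpoint hc h, argSum_eq_erase c s, arg_eq_pi_iff.2 ⟨hre, him⟩]
    cases β <;> (simp; try ring)
  have hsideint : ∃ n : ℤ, T.side c (s, β) = 2 * Real.pi * n := by
    rw [side, ← argSum_eq_midpoint hc h]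
    obtain ⟨n, hn⟩ := hc p hends
    refine ⟨n - if β then 0 else c s, ?_⟩
    rw [hn]
    cases β <;> (simp; try ring)
  have hlim : Tendsto (T.argSum c) (𝓝[{q | 0 < ((T.head (s, β) - q) / (T.tail (s, β) - q)).im}] p)
      (𝓝 (T.side c (s, β))) := by
    rw [hside]
    simp only [funext (argSum_eq_erase (T := T) c s)]
    refine Tendsto.add (Tendsto.const_mul _ ?_) (hrest.mono_left nhdsWithin_le_nhds)
    cases β
    · refine (tendsto_arg_nhdsWithin_im_neg_of_re_neg_of_im_zero hre him).comp
        (tendsto_nhdsWithin_iff.2 ⟨hdiv.tendsto.mono_left nhdsWithin_le_nhds, ?_⟩)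
      refine eventually_mem_nhdsWithin.mono fun q hq => ?_
      simp only [Set.mem_ofPred_eq, head, tail] at hq ⊢
      simp only [Bool.false_eq_true, if_false] at hq
      -- Reversing the direction inverts the quotient, which flips the sign of the imaginary part.
      rw [← inv_div, inv_im] at hq
      by_contra hcon
      have := div_nonpos_of_nonpos_of_nonneg (neg_nonpos.2 (not_lt.1 hcon))
        (normSq_nonneg ((T.b s - q) / (T.a s - q)))
      linarith
    · have := (tendsto_arg_nhdsWithin_im_nonneg_of_re_neg_of_im_zero hre him)
      refine this.comp
        (tendsto_nhdsWithin_iff.2 ⟨hdiv.tendsto.mono_left nhdsWithin_le_nhds, ?_⟩)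
      refine eventually_mem_nhdsWithin.mono fun q hq => ?_
      simp only [Set.mem_ofPred_eq, head, tail, if_true] at hq ⊢
      exact hq.le
  have hclose := hlim.eventually (Metric.ball_mem_nhds _ Real.two_pi_pos)
  rw [eventually_nhdsWithin_iff] at hclose
  filter_upwards [hclose, hint] with q h1 h2 hq
  exact eq_of_abs_sub_lt_two_pi h2 hsideint (by simpa [Real.dist_eq] using h1 hq)

end SegmentSystem

end SimpleGraph

/-! ### Turning around the end of a segment -/

namespace SimpleGraph

open Filter Topology Complex

namespace SegmentSystem

variable {S : Type*} {T : SegmentSystem S}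

theorem segment_head_tail (d : S × Bool) :
    segment ℝ (T.head d) (T.tail d) = segment ℝ (T.a d.1) (T.b d.1) := by
  obtain ⟨s, _ | _⟩ := d
  · rfl
  · exact segment_symm ℝ _ _

theorem openSegment_head_tail (d : S × Bool) :
    openSegment ℝ (T.head d) (T.tail d) = openSegment ℝ (T.a d.1) (T.b d.1) := by
  obtain ⟨s, _ | _⟩ := d
  · rfl
  · exact openSegment_symm ℝ _ _

theorem head_ne_tail (d : S × Bool) : T.head d ≠ T.tail d := by
  obtain ⟨s, _ | _⟩ := d
  · exact T.ne s
  · exact (T.ne s).symm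

/-- The clockwise angle, in `(0, 2 * π)`, of a direction that is not a positive real number. -/
noncomputable def clockwiseAngle (z : ℂ) : ℝ := Real.pi - arg (-z)

theorem clockwiseAngle_mul_exp {κ θ : ℝ} (hκ : 0 < κ) (h0 : 0 < θ) (h1 : θ < 2 * Real.pi) :
    clockwiseAngle (κ * exp (-(θ * I))) = θ := by
  have h : -(κ * exp (-(θ * I))) = κ * exp ((Real.pi - θ : ℝ) * I) := by
    push_cast
    rw [sub_mul, sub_eq_add_neg, exp_add, exp_pi_mul_I]
    ring
  rw [clockwiseAngle, h, arg_real_mul _ hκ, arg_exp_mul_I, toIocMod_eq_self Real.two_pi_pos |>.2]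
  · ring
  · constructor <;> linarith

theorem eq_norm_mul_exp_clockwiseAngle (z : ℂ) :
    z = ‖z‖ * exp (-(clockwiseAngle z * I)) := by
  have h := norm_mul_exp_arg_mul_I (-z)
  rw [norm_neg] at h
  rw [clockwiseAngle]
  push_cast
  rw [show -((Real.pi - arg (-z) : ℂ) * I) = arg (-z) * I - Real.pi * I by ring, exp_sub,
    exp_pi_mul_I, div_neg, div_one, mul_neg, h, neg_neg]

theorem clockwiseAngle_pos {z : ℂ} (hz : -z ∈ slitPlane) : 0 < clockwiseAngle z := by
  have := (arg_le_pi (-z)).lt_of_ne (slitPlane_arg_ne_pi hz)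
  rw [clockwiseAngle]
  linarith

theorem clockwiseAngle_lt (z : ℂ) : clockwiseAngle z < 2 * Real.pi := by
  have := neg_pi_lt_arg (-z)
  rw [clockwiseAngle]
  linarith

/-- Near the end of a directed segment, slightly clockwise from it, one is on its left. -/
theorem im_pos_near_head {v z : ℂ} (hz : z ≠ 0) {ρ θ : ℝ} (hρ0 : 0 < ρ)
    (h0 : 0 < θ) (h1 : θ < Real.pi) :
    0 < ((v - (v + ρ * exp (-(θ * I)) * z)) /
      (v + z - (v + ρ * exp (-(θ * I)) * z))).im := by
  have hs := Real.sin_pos_of_pos_of_lt_pi h0 h1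
  have hc := Real.sin_sq_add_cos_sq θ
  have he : exp (-(θ * I)) = ⟨Real.cos θ, -Real.sin θ⟩ := by
    rw [← neg_mul, ← ofReal_neg, exp_mul_I, ← ofReal_cos, ← ofReal_sin]
    apply Complex.ext <;> simp [cos_ofReal_re, sin_ofReal_re]
  have e : (v - (v + ρ * exp (-(θ * I)) * z)) / (v + z - (v + ρ * exp (-(θ * I)) * z)) =
      (-(ρ * exp (-(θ * I)))) / (1 - ρ * exp (-(θ * I))) := by
    rw [show v - (v + ρ * exp (-(θ * I)) * z) = -(ρ * exp (-(θ * I))) * z by ring,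
      show v + z - (v + ρ * exp (-(θ * I)) * z) = (1 - ρ * exp (-(θ * I))) * z by ring,
      mul_div_mul_right _ _ hz]
  rw [e, he, div_im, ← sub_div]
  apply div_pos
  · simp
    nlinarith [mul_pos hρ0 hs]
  · rw [normSq_pos]
    intro hcon
    have := congrArg im hcon
    simp at this
    rcases this with h | h <;> linarith

/-- Near the start of a directed segment, slightly anticlockwise from it, one is on its left. -/
theorem im_pos_near_tail {v z : ℂ} (hz : z ≠ 0) {ρ θ : ℝ} (hρ0 : 0 < ρ)
    (h0 : 0 < θ) (h1 : θ < Real.pi) :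
    0 < ((v + z - (v + ρ * exp (θ * I) * z)) / (v - (v + ρ * exp (θ * I) * z))).im := by
  have hs := Real.sin_pos_of_pos_of_lt_pi h0 h1
  have he : exp (-(θ * I)) = ⟨Real.cos θ, -Real.sin θ⟩ := by
    rw [← neg_mul, ← ofReal_neg, exp_mul_I, ← ofReal_cos, ← ofReal_sin]
    apply Complex.ext <;> simp [cos_ofReal_re, sin_ofReal_re]
  have hρ : (ρ : ℂ) ≠ 0 := by exact_mod_cast hρ0.ne'
  have e : (v + z - (v + ρ * exp (θ * I) * z)) / (v - (v + ρ * exp (θ * I) * z)) =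
      1 - (ρ⁻¹ : ℝ) * exp (-(θ * I)) := by
    rw [show v + z - (v + ρ * exp (θ * I) * z) = (1 - ρ * exp (θ * I)) * z by ring,
      show v - (v + ρ * exp (θ * I) * z) = (-(ρ * exp (θ * I))) * z by ring,
      mul_div_mul_right _ _ hz, exp_neg]
    have := exp_ne_zero (θ * I)
    push_cast
    field_simp
    ring
  rw [e, he]
  simp
  positivity

theorem mem_openSegment_add_mul {v z : ℂ} {ρ : ℝ} (hρ0 : 0 < ρ) (hρ1 : ρ < 1) :
    v + ρ * z ∈ openSegment ℝ v (v + z) :=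
  ⟨1 - ρ, ρ, by linarith, hρ0, by ring, by simp only [real_smul]; push_cast; ring⟩

theorem exists_pos_of_mem_segment {v y p : ℂ} (h : p ∈ segment ℝ v y) (hp : p ≠ v) :
    ∃ k : ℝ, 0 < k ∧ p - v = k * (y - v) := by
  obtain ⟨x, k, hx, hk, hxk, rfl⟩ := h
  refine ⟨k, hk.lt_of_ne ?_, ?_⟩
  · rintro rfl
    apply hp
    rw [add_zero] at hxk
    simp [hxk]
  · rw [eq_sub_of_add_eq hxk]
    simp only [real_smul]
    push_cast
    ring

variable [Fintype S]

/-- At the end of a directed segment, the left side continues as the left side of the segment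
which is next in clockwise order. -/
theorem exists_next_side (d : S × Bool)
    (hd : ∃ t, t ≠ d.1 ∧ (T.head d = T.a t ∨ T.head d = T.b t)) :
    ∃ d' : S × Bool, d'.1 ≠ d.1 ∧ T.tail d' = T.head d ∧
      ∀ c, T.IsCycle c → T.side c d' = T.side c d := by
  classical
  set v := T.head d with hv
  set z := T.tail d - v with hz
  have hz0 : z ≠ 0 := sub_ne_zero.2 (head_ne_tail d).symm
  -- Of the other segments leaving `v`, the first one met when turning clockwise from `d` is chosen.
  -- The open sector in between is free of segments near `v`, so `argSum` is constant on a small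
  -- circular arc there.
  let E : Finset (S × Bool) := Finset.univ.filter fun d' => d'.1 ≠ d.1 ∧ T.tail d' = v
  have hE : E.Nonempty := by
    obtain ⟨t, ht, h | h⟩ := hd
    · exact ⟨(t, true), by simp [E, ht, tail, h]⟩
    · exact ⟨(t, false), by simp [E, ht, tail, h]⟩
  obtain ⟨d', hd'E, hmin⟩ := E.exists_min_image
    (fun d' => clockwiseAngle ((T.head d' - v) / z)) hE
  obtain ⟨hne, htail⟩ : d'.1 ≠ d.1 ∧ T.tail d' = v := by simpa [E] using hd'E
  refine ⟨d', hne, htail, fun c hc => ?_⟩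
  set w := T.head d' - v with hw
  have hw0 : w ≠ 0 := sub_ne_zero.2 (htail ▸ head_ne_tail d')
  set γ := clockwiseAngle (w / z) with hγ
  have hγlt : γ < 2 * Real.pi := clockwiseAngle_lt _
  -- Two segments leaving `v` in the same direction would overlap near `v`.
  have hnotray : ∀ k : ℝ, 0 < k → w ≠ k * z := by
    intro k hk hwk
    obtain ⟨ρ, hρ0, hρ1, hρk⟩ : ∃ ρ : ℝ, 0 < ρ ∧ ρ < 1 ∧ ρ * k < 1 := by
      refine ⟨1 / (1 + 1 + k), by positivity, ?_, ?_⟩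
      · rw [div_lt_one (by positivity)]; linarith
      · rw [one_div, inv_mul_lt_iff₀ (by positivity)]; linarith
    have h1 : v + ρ * w ∈ openSegment ℝ (T.a d'.1) (T.b d'.1) := by
      rw [← openSegment_head_tail, openSegment_symm, htail]
      simpa [hw] using mem_openSegment_add_mul (v := v) (z := w) hρ0 hρ1
    have h2 : v + ρ * w ∈ segment ℝ (T.a d.1) (T.b d.1) := by
      rw [← segment_head_tail]
      have := mem_openSegment_add_mul (v := v) (z := z) (mul_pos hρ0 hk) hρk
      rw [hwk]
      apply openSegment_subset_segment
      push_cast at this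
      rw [mul_assoc] at this
      simpa [hz] using this
    exact notMem_segment_of_mem_openSegment hne h1 h2
  have hγpos : 0 < γ := by
    apply clockwiseAngle_pos
    by_contra hcon
    rw [mem_slitPlane_iff, not_or, not_lt, not_ne_iff] at hcon
    obtain ⟨h1, h2⟩ := hcon
    have hwz : w / z = ((w / z).re : ℂ) := Complex.ext (by simp) (by simpa using h2)
    refine hnotray (w / z).re (lt_of_le_of_ne (by simpa using h1) ?_) ?_
    · intro h0
      rw [← h0] at hwz
      exact div_ne_zero hw0 hz0 (by simpa using hwz)
    · rw [← hwz, div_mul_cancel₀ _ hz0]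
  -- a radius that stays clear of all segments not ending in `v`
  obtain ⟨ρ, hρ0, hρ1, hρw, hρfar⟩ : ∃ ρ : ℝ, 0 < ρ ∧ ρ < 1 ∧ ρ * (‖z‖ / ‖w‖) < 1 ∧
      ∀ t, v ∉ segment ℝ (T.a t) (T.b t) → ∀ q, Dist.dist q v = ρ * ‖z‖ →
        q ∉ segment ℝ (T.a t) (T.b t) := by
    have h1 : ∀ᶠ ρ : ℝ in 𝓝[>] 0, ρ < 1 :=
      nhdsWithin_le_nhds (eventually_lt_nhds one_pos)
    have h2 : ∀ᶠ ρ : ℝ in 𝓝[>] 0, ρ * (‖z‖ / ‖w‖) < 1 := by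
      apply nhdsWithin_le_nhds
      have : Tendsto (fun ρ : ℝ => ρ * (‖z‖ / ‖w‖)) (𝓝 0) (𝓝 (0 * (‖z‖ / ‖w‖))) :=
        tendsto_id.mul_const _
      exact this.eventually (eventually_lt_nhds (by simp))
    have h3 : ∀ᶠ ρ : ℝ in 𝓝[>] 0, ∀ t, v ∉ segment ℝ (T.a t) (T.b t) → ∀ q,
        Dist.dist q v = ρ * ‖z‖ → q ∉ segment ℝ (T.a t) (T.b t) := by
      rw [eventually_all]
      intro t
      by_cases ht : v ∈ segment ℝ (T.a t) (T.b t)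
      · exact Eventually.of_forall fun _ h => absurd ht h
      have hclosed : IsClosed (segment ℝ (T.a t) (T.b t)) := by
        rw [← convexHull_pair]
        exact ((Set.toFinite _).isCompact_convexHull ℝ).isClosed
      obtain ⟨ε, hε, hball⟩ := Metric.isOpen_iff.1 hclosed.isOpen_compl v ht
      have : Tendsto (fun ρ : ℝ => ρ * ‖z‖) (𝓝 0) (𝓝 (0 * ‖z‖)) := tendsto_id.mul_const _
      have := this.eventually (eventually_lt_nhds (show 0 * ‖z‖ < ε by simpa using hε))
      refine nhdsWithin_le_nhds (this.mono fun ρ hρ _ q hq => hball ?_)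
      rw [Metric.mem_ball, hq]
      exact hρ
    obtain ⟨ρ, h⟩ := (h1.and (h2.and (h3.and self_mem_nhdsWithin))).exists
    exact ⟨ρ, h.2.2.2, h.1, h.2.1, h.2.2.1⟩
  have hznorm : 0 < ‖z‖ := norm_pos_iff.2 hz0
  have hwnorm : 0 < ‖w‖ := norm_pos_iff.2 hw0
  -- A clockwise circular arc about `v`, which starts on `d` at `θ = 0` and reaches `d'` at `θ = γ`.
  let q : ℝ → ℂ := fun θ => v + ρ * exp (-(θ * I)) * z
  have hqcont : Continuous q := by fun_prop
  have hqv : ∀ θ, q θ - v = ρ * exp (-(θ * I)) * z := fun θ => by simp [q]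
  have hqnorm : ∀ θ, Dist.dist (q θ) v = ρ * ‖z‖ := fun θ => by
    rw [dist_eq_norm, hqv, norm_mul, norm_mul, ← neg_mul, ← ofReal_neg, norm_exp_ofReal_mul_I,
      norm_real, Real.norm_of_nonneg hρ0.le, mul_one]
  have hqne : ∀ θ, q θ ≠ v := fun θ h => by
    have := hqnorm θ
    rw [h, _root_.dist_self] at this
    exact (mul_pos hρ0 hznorm).ne this
  have hfree : ∀ θ ∈ Set.Ioo 0 γ, ∀ t, q θ ∉ segment ℝ (T.a t) (T.b t) := by
    rintro θ ⟨h0, h1⟩ t ht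
    by_cases hvt : v ∈ segment ℝ (T.a t) (T.b t)
    swap
    · exact hρfar t hvt _ (hqnorm θ) ht
    obtain ⟨x, hx1, hx2⟩ : ∃ x : S × Bool, x.1 = t ∧ T.tail x = v := by
      by_cases htd : t = d.1
      · refine ⟨(t, !d.2), rfl, ?_⟩
        rw [hv, tail, head, htd]
        cases d.2 <;> rfl
      · have hvd : v ∈ segment ℝ (T.a d.1) (T.b d.1) := by
          rw [← segment_head_tail]
          exact left_mem_segment ℝ _ _
        rcases (T.inter t d.1 htd v hvt hvd).1 with h | h
        · exact ⟨(t, true), rfl, by simp [tail, h]⟩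
        · exact ⟨(t, false), rfl, by simp [tail, h]⟩
    rw [← hx1, ← segment_head_tail, segment_symm, hx2] at ht
    obtain ⟨k, hk, hqk⟩ := exists_pos_of_mem_segment ht (hqne θ)
    rw [hqv] at hqk
    have hk' : (k : ℂ) ≠ 0 := by exact_mod_cast hk.ne'
    have hdir : (T.head x - v) / z = ((ρ / k : ℝ) : ℂ) * exp (-(θ * I)) := by
      push_cast
      field_simp
      linear_combination -hqk
    have hang : clockwiseAngle ((T.head x - v) / z) = θ := by
      rw [hdir]
      exact clockwiseAngle_mul_exp (div_pos hρ0 hk) h0 (h1.trans hγlt)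
    -- The segment of `d` has angle `0`, and any other segment at `v` has angle at least `γ`;
    -- neither can be `θ`.
    by_cases htd : t = d.1
    · have hhead : T.head x = T.tail d := by
        obtain ⟨s, β⟩ := x
        obtain ⟨s', β'⟩ := d
        simp only at hx1 htd
        subst hx1 htd
        rw [hv] at hx2
        have hn := T.ne s
        cases β <;> cases β' <;> simp only [tail, head] at hx2 ⊢ <;> simp_all
      rw [hhead, ← hz, div_self hz0] at hang
      have h1 : clockwiseAngle 1 = 0 := by simp [clockwiseAngle]
      linarith
    · have := hmin x (by simp [E, hx1, htd, hx2])
      simp only [hang] at this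
      linarith
  have hval : ∀ θ ∈ Set.Ioo 0 γ, ∀ θ' ∈ Set.Ioo 0 γ, T.argSum c (q θ) = T.argSum c (q θ') := by
    intro θ hθ θ' hθ'
    refine isPreconnected_Ioo.constant_of_mapsTo isDiscrete_range_two_pi_mul_int
      (f := fun θ => T.argSum c (q θ)) ?_ ?_ hθ hθ'
    · exact fun x hx => (ContinuousAt.comp (f := q) (continuousAt_argSum c (hfree x hx))
        hqcont.continuousAt).continuousWithinAt
    · intro x hx
      obtain ⟨n, hn⟩ := hc (q x) fun t =>
        ⟨fun h => hfree x hx t (h ▸ left_mem_segment ℝ _ _),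
          fun h => hfree x hx t (h ▸ right_mem_segment ℝ _ _)⟩
      exact ⟨n, hn.symm⟩
  have hstart : ∀ᶠ θ in 𝓝[>] (0 : ℝ), θ ∈ Set.Ioo 0 γ ∧ T.argSum c (q θ) = T.side c d := by
    have hq0 : q 0 ∈ openSegment ℝ (T.a d.1) (T.b d.1) := by
      rw [← openSegment_head_tail]
      simpa [q, hz] using mem_openSegment_add_mul (v := v) (z := z) hρ0 hρ1
    have h1 := hqcont.continuousAt.eventually (side_eventually hc d hq0)
    filter_upwards [nhdsWithin_le_nhds h1, Ioo_mem_nhdsGT hγpos, Ioo_mem_nhdsGT Real.pi_pos]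
      with θ h1 h2 h3
    refine ⟨h2, h1 ?_⟩
    have := im_pos_near_head (v := v) hz0 hρ0 h3.1 h3.2
    rwa [hz, add_sub_cancel] at this
  have hfinish : ∀ᶠ θ in 𝓝[<] γ, θ ∈ Set.Ioo 0 γ ∧ T.argSum c (q θ) = T.side c d' := by
    -- The same arc described from `w`, turning back anticlockwise by `γ - θ`; this is the shape
    -- required by `im_pos_near_tail`.
    have hqw : ∀ θ, q θ = v + (ρ * (‖z‖ / ‖w‖) : ℝ) * exp ((γ - θ : ℝ) * I) * w := by
      intro θ
      have h1 := eq_norm_mul_exp_clockwiseAngle (w / z)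
      rw [← hγ, div_eq_iff hz0, norm_div] at h1
      have hzc : (‖z‖ : ℂ) ≠ 0 := by exact_mod_cast hznorm.ne'
      have hwc : (‖w‖ : ℂ) ≠ 0 := by exact_mod_cast hwnorm.ne'
      have h2 : exp ((γ - θ : ℝ) * I) * exp (-(γ * I)) = exp (-(θ * I)) := by
        rw [← exp_add]
        congr 1
        push_cast
        ring
      refine Eq.trans ?_ (congrArg (fun u => v + (ρ * (‖z‖ / ‖w‖) : ℝ) *
        exp ((γ - θ : ℝ) * I) * u) h1).symm
      simp only [q, ← h2]
      push_cast
      field_simp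
    have hρ'0 : 0 < ρ * (‖z‖ / ‖w‖) := by positivity
    have hqγ : q γ ∈ openSegment ℝ (T.a d'.1) (T.b d'.1) := by
      rw [← openSegment_head_tail, openSegment_symm, htail, hqw]
      simpa [hw] using mem_openSegment_add_mul (v := v) (z := w) hρ'0 hρw
    have h1 := hqcont.continuousAt.eventually (side_eventually hc d' hqγ)
    filter_upwards [nhdsWithin_le_nhds h1, Ioo_mem_nhdsLT hγpos,
      Ioo_mem_nhdsLT (show γ - Real.pi < γ by linarith [Real.pi_pos])] with θ h1 h2 h3
    refine ⟨h2, h1 ?_⟩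
    have := im_pos_near_tail (v := v) hw0 hρ'0 (sub_pos.2 h3.2)
      (show γ - θ < Real.pi by linarith [h3.1])
    rw [← hqw, hw, add_sub_cancel] at this
    rw [htail]
    exact this
  obtain ⟨θ, hθ, h1⟩ := hstart.exists
  obtain ⟨θ', hθ', h2⟩ := hfinish.exists
  rw [← h1, ← h2, hval θ hθ θ' hθ']

end SegmentSystem

end SimpleGraph

namespace SimpleGraph

open Filter Topology Complex

/-! ### Plane drawings as systems of segments -/

namespace PolygonalArc

variable (A : PolygonalArc)

/-- The condition `simple` compares two segments, so the corner is treated as the start of a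
segment, or, if it is the last corner, as the end of the final one. -/
theorem corner_mem_segment {k : Fin (A.n + 1)} {i : Fin A.n}
    (h : A.pt k ∈ segment ℝ (A.pt i.castSucc) (A.pt i.succ)) : k = i.castSucc ∨ k = i.succ := by
  rcases Fin.eq_castSucc_or_eq_last k with ⟨j, rfl⟩ | rfl
  · rcases lt_trichotomy j i with hji | rfl | hij
    · have := (A.simple j i hji ⟨left_mem_segment ℝ _ _, h⟩).1
      exact absurd (A.pt_injective this) (Fin.castSucc_lt_succ).ne
    · exact Or.inl rfl
    · exact Or.inr (A.pt_injective (A.simple i j hij ⟨h, left_mem_segment ℝ _ _⟩).1)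
  · by_cases hi : i.succ = Fin.last A.n
    · exact Or.inr hi.symm
    · have hlt : i.val + 1 < A.n := by
        have h1 := i.2
        have h2 : i.val + 1 ≠ A.n := fun h => hi (Fin.ext h)
        omega
      let j : Fin A.n := ⟨A.n - 1, by omega⟩
      have hj : j.succ = Fin.last A.n := Fin.ext (by simp [j]; omega)
      have hij : i < j := Fin.lt_def.2 (by simp only [j]; omega)
      have := (A.simple i j hij ⟨h, hj ▸ right_mem_segment ℝ _ _⟩).2
      rw [← hj] at this
      exact absurd (A.pt_injective this) (Fin.castSucc_lt_succ).ne'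

theorem segment_subset_carrier (i : Fin A.n) :
    segment ℝ (A.pt i.castSucc) (A.pt i.succ) ⊆ A.carrier :=
  Set.subset_iUnion (fun i : Fin A.n => segment ℝ (A.pt i.castSucc) (A.pt i.succ)) i

end PolygonalArc

/-- The plane as the complex line. -/
noncomputable def planeToComplex : ℝ × ℝ →ₗ[ℝ] ℂ := Complex.equivRealProdLm.symm.toLinearMap

theorem planeToComplex_injective : Function.Injective planeToComplex :=
  Complex.equivRealProdLm.symm.injective

theorem mem_segment_planeToComplex {p x y : ℝ × ℝ} :
    planeToComplex p ∈ segment ℝ (planeToComplex x) (planeToComplex y) ↔ p ∈ segment ℝ x y := by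
  have h := image_segment ℝ planeToComplex.toAffineMap x y
  simp only [LinearMap.coe_toAffineMap] at h
  rw [← h, planeToComplex_injective.mem_set_image]

namespace PlaneDrawing

variable {V : Type u} {G : SimpleGraph V} (D : G.PlaneDrawing)

/-- A drawing restricts to a subgraph. -/
def restrict {H : SimpleGraph V} (h : H ≤ G) : H.PlaneDrawing where
  pos := D.pos
  pos_injective := D.pos_injective
  arc e := D.arc ⟨e, edgeSet_mono h e.2⟩
  ends e := D.ends ⟨e, edgeSet_mono h e.2⟩
  vertex_on_arc e := D.vertex_on_arc ⟨e, edgeSet_mono h e.2⟩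
  arc_inter e f hef := D.arc_inter ⟨e, edgeSet_mono h e.2⟩ ⟨f, edgeSet_mono h f.2⟩
    fun he => hef (Subtype.ext (Subtype.mk.inj he))

theorem exists_ends (e : G.edgeSet) : ∃ x : V × V, (e : Sym2 V) = s(x.1, x.2) ∧
    D.pos x.1 = (D.arc e).source ∧ D.pos x.2 = (D.arc e).target := by
  have h := D.ends e
  revert h
  obtain ⟨e, he⟩ := e
  induction e using Sym2.ind with
  | h x y =>
    intro h
    rw [Sym2.map_mk, Sym2.eq_iff] at h
    rcases h with ⟨h1, h2⟩ | ⟨h1, h2⟩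
    · exact ⟨(x, y), rfl, h1.symm, h2.symm⟩
    · exact ⟨(y, x), Sym2.eq_swap, h1.symm, h2.symm⟩

/-- The vertex at which the arc of an edge starts. -/
noncomputable def src (e : G.edgeSet) : V := (D.exists_ends e).choose.1

/-- The vertex at which the arc of an edge stops. -/
noncomputable def tgt (e : G.edgeSet) : V := (D.exists_ends e).choose.2

theorem edge_eq (e : G.edgeSet) : (e : Sym2 V) = s(D.src e, D.tgt e) :=
  (D.exists_ends e).choose_spec.1

theorem pos_src (e : G.edgeSet) : D.pos (D.src e) = (D.arc e).pt 0 :=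
  (D.exists_ends e).choose_spec.2.1

theorem pos_tgt (e : G.edgeSet) : D.pos (D.tgt e) = (D.arc e).pt (Fin.last _) :=
  (D.exists_ends e).choose_spec.2.2

theorem adj_src_tgt (e : G.edgeSet) : G.Adj (D.src e) (D.tgt e) := by
  have := e.2
  rwa [D.edge_eq e] at this

theorem arc_n_pos (e : G.edgeSet) : 0 < (D.arc e).n := by
  by_contra h
  have h0 : (0 : Fin ((D.arc e).n + 1)) = Fin.last _ := Fin.ext (by simp; omega)
  exact (D.adj_src_tgt e).ne (D.pos_injective (by rw [pos_src, pos_tgt, h0]))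

theorem eq_end_of_mem {e : G.edgeSet} {v : V} (h : v ∈ (e : Sym2 V)) :
    D.pos v = (D.arc e).pt 0 ∨ D.pos v = (D.arc e).pt (Fin.last _) := by
  rw [D.edge_eq e, Sym2.mem_iff] at h
  rcases h with rfl | rfl
  · exact Or.inl (D.pos_src e)
  · exact Or.inr (D.pos_tgt e)

/-- A common point of two arcs is the position of a common end. -/
theorem exists_vertex_of_mem_of_mem {e f : G.edgeSet} (hef : e ≠ f) {i : Fin (D.arc e).n}
    {j : Fin (D.arc f).n} {p : ℝ × ℝ}
    (he : p ∈ segment ℝ ((D.arc e).pt i.castSucc) ((D.arc e).pt i.succ))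
    (hf : p ∈ segment ℝ ((D.arc f).pt j.castSucc) ((D.arc f).pt j.succ)) :
    ∃ v, D.pos v = p ∧ v ∈ (e : Sym2 V) ∧ v ∈ (f : Sym2 V) := by
  obtain ⟨v, hv, hp⟩ := D.arc_inter e f hef ⟨(D.arc e).segment_subset_carrier i he,
    (D.arc f).segment_subset_carrier j hf⟩
  exact ⟨v, hp, hv⟩

theorem eq_end_of_mem_segment {e : G.edgeSet} {v : V} (h : v ∈ (e : Sym2 V))
    {i : Fin (D.arc e).n}
    (hi : D.pos v ∈ segment ℝ ((D.arc e).pt i.castSucc) ((D.arc e).pt i.succ)) :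
    D.pos v = (D.arc e).pt i.castSucc ∨ D.pos v = (D.arc e).pt i.succ := by
  rcases D.eq_end_of_mem h with h | h <;> rw [h] at hi ⊢ <;>
    exact ((D.arc e).corner_mem_segment hi).imp (congrArg _) (congrArg _)

/-- The segments of the arcs of a drawing. -/
noncomputable def segments : SegmentSystem (Σ e : G.edgeSet, Fin (D.arc e).n) where
  a s := planeToComplex ((D.arc s.1).pt s.2.castSucc)
  b s := planeToComplex ((D.arc s.1).pt s.2.succ)
  ne s h := (Fin.castSucc_lt_succ (i := s.2)).ne
    ((D.arc s.1).pt_injective (planeToComplex_injective h))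
  inter := by
    rintro ⟨e, i⟩ ⟨f, j⟩ hst p hp hq
    obtain ⟨p, rfl⟩ : ∃ p', planeToComplex p' = p := Complex.equivRealProdLm.symm.surjective p
    rw [mem_segment_planeToComplex] at hp hq
    simp only [planeToComplex_injective.eq_iff]
    by_cases hef : e = f
    · subst hef
      have hij : i ≠ j := fun h => hst (by rw [h])
      rcases hij.lt_or_gt with h | h
      · obtain ⟨h1, h2⟩ := (D.arc e).simple i j h ⟨hp, hq⟩
        exact ⟨Or.inr h1, Or.inl h2⟩
      · obtain ⟨h1, h2⟩ := (D.arc e).simple j i h ⟨hq, hp⟩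
        exact ⟨Or.inl h2, Or.inr h1⟩
    · obtain ⟨v, rfl, h1, h2⟩ := D.exists_vertex_of_mem_of_mem hef hp hq
      exact ⟨D.eq_end_of_mem_segment h1 hp, D.eq_end_of_mem_segment h2 hq⟩

/-- The first vertex of a directed edge. -/
noncomputable def dartTail (x : G.edgeSet × Bool) : V := if x.2 then D.src x.1 else D.tgt x.1

/-- The last vertex of a directed edge. -/
noncomputable def dartHead (x : G.edgeSet × Bool) : V := if x.2 then D.tgt x.1 else D.src x.1

theorem edge_eq_dart (x : G.edgeSet × Bool) : (x.1 : Sym2 V) = s(D.dartTail x, D.dartHead x) := by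
  obtain ⟨e, _ | _⟩ := x
  · exact (D.edge_eq e).trans Sym2.eq_swap
  · exact D.edge_eq e

/-- A corner of an arc that lies on a segment of the drawing and is no end of the arc is a corner
of this segment, and the segment belongs to the arc. -/
theorem eq_of_inner_corner {e : G.edgeSet} {i : Fin (D.arc e).n} (h0 : i.succ ≠ 0)
    (hl : i.succ ≠ Fin.last _) {s : Σ e : G.edgeSet, Fin (D.arc e).n}
    (h : (D.arc e).pt i.succ ∈
      segment ℝ ((D.arc s.1).pt s.2.castSucc) ((D.arc s.1).pt s.2.succ)) :
    s.1 = e := by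
  by_contra hne
  obtain ⟨v, hv, h1, h2⟩ := D.exists_vertex_of_mem_of_mem (Ne.symm hne)
    (right_mem_segment ℝ _ _) h
  rcases D.eq_end_of_mem h1 with h | h <;> rw [hv] at h
  · exact h0 ((D.arc e).pt_injective h)
  · exact hl ((D.arc e).pt_injective h)

theorem tail_mem_segment (d : (Σ e : G.edgeSet, Fin (D.arc e).n) × Bool) {p : ℝ × ℝ}
    (h : D.segments.tail d = planeToComplex p) :
    p ∈ segment ℝ ((D.arc d.1.1).pt d.1.2.castSucc) ((D.arc d.1.1).pt d.1.2.succ) := by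
  rw [← mem_segment_planeToComplex, ← h]
  obtain ⟨s, _ | _⟩ := d
  · exact right_mem_segment ℝ _ _
  · exact left_mem_segment ℝ _ _

theorem tail_eq_iff (e : G.edgeSet) (i : Fin (D.arc e).n) (β : Bool) (p : ℝ × ℝ) :
    D.segments.tail (⟨e, i⟩, β) = planeToComplex p ↔
      (D.arc e).pt (if β then i.castSucc else i.succ) = p := by
  cases β <;> exact planeToComplex_injective.eq_iff

variable [Fintype (Σ e : G.edgeSet, Fin (D.arc e).n)]

/-- The side value does not change along an arc: one step. -/
theorem side_succ {c : (Σ e : G.edgeSet, Fin (D.arc e).n) → ℤ} (hc : D.segments.IsCycle c)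
    (e : G.edgeSet) (β : Bool) (i j : Fin (D.arc e).n) (hij : i.val + 1 = j.val) :
    D.segments.side c (⟨e, i⟩, β) = D.segments.side c (⟨e, j⟩, β) := by
  have hij' : j.castSucc = i.succ := Fin.ext (by simp [hij])
  have h0 : i.succ ≠ 0 := Fin.succ_ne_zero i
  have hl : i.succ ≠ Fin.last _ := by
    rw [← hij']
    exact (Fin.castSucc_lt_last j).ne
  have hne : (⟨e, i⟩ : Σ e : G.edgeSet, Fin (D.arc e).n) ≠ ⟨e, j⟩ := by
    intro h
    have := eq_of_heq (Sigma.mk.inj h).2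
    rw [this] at hij
    omega
  -- At an inner corner only the segments `i` and `j` meet, so the continuation given by
  -- `exists_next_side` is forced.
  cases β
  · obtain ⟨d', hd', htail, hside⟩ := D.segments.exists_next_side (⟨e, j⟩, false)
      ⟨⟨e, i⟩, hne, Or.inr (congrArg (fun k => planeToComplex ((D.arc e).pt k)) hij')⟩
    have htail' : D.segments.tail d' = planeToComplex ((D.arc e).pt i.succ) :=
      htail.trans (congrArg (fun k => planeToComplex ((D.arc e).pt k)) hij')
    obtain ⟨⟨e', k⟩, β'⟩ := d'
    obtain rfl : e' = e := D.eq_of_inner_corner h0 hl (D.tail_mem_segment _ htail')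
    rw [tail_eq_iff] at htail'
    have hk := (D.arc e').pt_injective htail'
    cases β'
    · obtain rfl : k = i := Fin.succ_injective _ hk
      exact hside c hc
    · have : k = j := Fin.castSucc_injective _ (hk.trans hij'.symm)
      exact absurd (by rw [this]) hd'
  · obtain ⟨d', hd', htail, hside⟩ := D.segments.exists_next_side (⟨e, i⟩, true)
      ⟨⟨e, j⟩, hne.symm, Or.inl (congrArg (fun k => planeToComplex ((D.arc e).pt k)) hij'.symm)⟩
    have htail' : D.segments.tail d' = planeToComplex ((D.arc e).pt i.succ) := htail
    obtain ⟨⟨e', k⟩, β'⟩ := d'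
    obtain rfl : e' = e := D.eq_of_inner_corner h0 hl (D.tail_mem_segment _ htail')
    rw [tail_eq_iff] at htail'
    have hk := (D.arc e').pt_injective htail'
    cases β'
    · have : k = i := Fin.succ_injective _ hk
      exact absurd (by rw [this]) hd'
    · obtain rfl : k = j := Fin.castSucc_injective _ (hk.trans hij'.symm)
      exact (hside c hc).symm

/-- The first segment of an arc. -/
def firstSegment (e : G.edgeSet) : Σ e : G.edgeSet, Fin (D.arc e).n := ⟨e, ⟨0, D.arc_n_pos e⟩⟩

theorem side_eq_first {c : (Σ e : G.edgeSet, Fin (D.arc e).n) → ℤ} (hc : D.segments.IsCycle c)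
    (e : G.edgeSet) (β : Bool) (i : Fin (D.arc e).n) :
    D.segments.side c (⟨e, i⟩, β) = D.segments.side c (D.firstSegment e, β) := by
  obtain ⟨i, hi⟩ := i
  induction i with
  | zero => rfl
  | succ i ih => rw [← ih (by omega)]; exact (D.side_succ hc e β _ _ rfl).symm

/-- At the end of a directed edge, the left side continues as the left side of another edge. -/
theorem exists_next_dart (x : G.edgeSet × Bool)
    (hx : ∃ f : G.edgeSet, f ≠ x.1 ∧ D.dartHead x ∈ (f : Sym2 V)) :
    ∃ y : G.edgeSet × Bool, y.1 ≠ x.1 ∧ D.dartTail y = D.dartHead x ∧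
      ∀ c, D.segments.IsCycle c →
        D.segments.side c (D.firstSegment y.1, y.2) =
          D.segments.side c (D.firstSegment x.1, x.2) := by
  obtain ⟨e, β⟩ := x
  obtain ⟨f, hf, hv⟩ := hx
  simp only at hf
  have hn := D.arc_n_pos e
  have hnf := D.arc_n_pos f
  set v := D.dartHead (e, β) with hvdef
  -- The segment by which the directed edge arrives at `v`: the last one of the arc, or the first
  -- one if the arc is run backwards.
  let i : Fin (D.arc e).n := if β then ⟨(D.arc e).n - 1, by omega⟩ else ⟨0, hn⟩
  have hhead : D.segments.head (⟨e, i⟩, β) = planeToComplex (D.pos v) := by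
    cases β
    · exact congrArg planeToComplex (D.pos_src e).symm
    · refine congrArg planeToComplex (Eq.trans ?_ (D.pos_tgt e).symm)
      refine congrArg _ (Fin.ext ?_)
      simp [i]
      omega
  have hlast : (⟨(D.arc f).n - 1, by omega⟩ : Fin (D.arc f).n).succ = Fin.last _ :=
    Fin.ext (by simp; omega)
  obtain ⟨d', hd', htail, hside⟩ := D.segments.exists_next_side (⟨e, i⟩, β) (by
    rw [hhead]
    rcases D.eq_end_of_mem hv with h | h
    · exact ⟨⟨f, ⟨0, hnf⟩⟩, fun h => hf (Sigma.mk.inj h).1, Or.inl (congrArg planeToComplex h)⟩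
    · refine ⟨⟨f, ⟨(D.arc f).n - 1, by omega⟩⟩, fun h => hf (Sigma.mk.inj h).1, Or.inr ?_⟩
      rw [h, ← hlast]
      rfl)
  rw [hhead] at htail
  have hmem := D.tail_mem_segment _ htail
  obtain ⟨⟨e', j⟩, β'⟩ := d'
  rw [tail_eq_iff] at htail
  have hve' : v ∈ (e' : Sym2 V) := D.vertex_on_arc e' v ((D.arc e').segment_subset_carrier j hmem)
  refine ⟨(e', β'), ?_, ?_, fun c hc => ?_⟩
  -- Only one segment of the arc of `e` has `v` as an end, namely `i`; so a different segment at `v`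
  -- belongs to a different edge.
  · rintro h
    obtain rfl : e' = e := h
    apply hd'
    have hpos : D.pos v = (D.arc e').pt (if β then Fin.last _ else 0) := by
      rw [hvdef]
      cases β
      · exact D.pos_src e'
      · exact D.pos_tgt e'
    have hk := (D.arc e').pt_injective (htail.trans hpos)
    have hval := congrArg Fin.val hk
    have hj := j.2
    have : j = i := by
      apply Fin.ext
      cases β <;> cases β' <;> simp at hval <;> simp [i] <;> omega
    rw [this]
  · apply D.pos_injective
    rw [← htail]
    rcases D.eq_end_of_mem hve' with h | h <;>
      have hval := congrArg Fin.val ((D.arc e').pt_injective (htail.trans h)) <;>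
      have hj := j.2
    · cases β'
      · simp at hval
      · have h1 : j.castSucc = 0 := Fin.ext (by simpa using hval)
        simp [h1, dartTail, D.pos_src]
    · cases β'
      · have h1 : j.succ = Fin.last _ := Fin.ext (by simpa using hval)
        simp [h1, dartTail, D.pos_tgt]
      · simp at hval
        omega
  · rw [← D.side_eq_first hc e' β' j, hside c hc, D.side_eq_first hc e β i]

end PlaneDrawing

end SimpleGraph

/-! ### The cycle space and the count of side classes -/

namespace SimpleGraph

open Complex

theorem finrank_range_add_finrank_ker_int {m n : Type*} [Finite m]
    (f : (m → ℤ) →ₗ[ℤ] (n → ℤ)) :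
    Module.finrank ℤ (LinearMap.range f) + Module.finrank ℤ (LinearMap.ker f) =
      Module.finrank ℤ (m → ℤ) := by
  rw [← (LinearMap.ker f).finrank_quotient_add_finrank, f.quotKerEquivRange.finrank_eq]

namespace PlaneDrawing

variable {V : Type u} {G : SimpleGraph V} (D : G.PlaneDrawing)

open Classical in
/-- The boundary of an integer combination of edges, at the vertices which are not isolated. -/
noncomputable def boundary [Fintype G.edgeSet] : (G.edgeSet → ℤ) →ₗ[ℤ] (G.support → ℤ) where
  toFun C v := ∑ e, C e * ((if D.tgt e = v then 1 else 0) - (if D.src e = v then 1 else 0))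
  map_add' C C' := by
    ext v
    simp only [Pi.add_apply, add_mul, Finset.sum_add_distrib]
  map_smul' m C := by
    ext v
    simp only [Pi.smul_apply, smul_eq_mul, mul_assoc, ← Finset.mul_sum, RingHom.id_apply]

variable [Fintype G.edgeSet]

/-- Modulo `2 * π` each angle is a difference of arguments at the two ends of a segment. The sum
telescopes along every arc, and regrouping by vertices leaves the boundary as coefficients. -/
theorem isCycle_of_boundary_eq_zero [Fintype V] {C : G.edgeSet → ℤ} (hC : D.boundary C = 0) :
    D.segments.IsCycle fun s => C s.1 := by
  classical
  intro p hp
  suffices h : (D.segments.argSum (fun s => C s.1) p : Real.Angle) = 0 by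
    obtain ⟨n, hn⟩ := Real.Angle.coe_eq_zero_iff.1 h
    exact ⟨n, by rw [← hn]; simp; ring⟩
  let g : ℝ × ℝ → Real.Angle := fun x => (arg (planeToComplex x - p) : Real.Angle)
  have hseg : ∀ s, (arg ((D.segments.b s - p) / (D.segments.a s - p)) : Real.Angle) =
      g ((D.arc s.1).pt s.2.succ) - g ((D.arc s.1).pt s.2.castSucc) := fun s =>
    arg_div_coe_angle (sub_ne_zero.2 (hp s).2.symm) (sub_ne_zero.2 (hp s).1.symm)
  have hsum : (D.segments.argSum (fun s => C s.1) p : Real.Angle) =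
      ∑ s : Σ e : G.edgeSet, Fin (D.arc e).n, C s.1 •
        (g ((D.arc s.1).pt s.2.succ) - g ((D.arc s.1).pt s.2.castSucc)) := by
    rw [SegmentSystem.argSum, ← Real.Angle.coe_coeHom, map_sum]
    refine Finset.sum_congr rfl fun s _ => ?_
    rw [← hseg, ← zsmul_eq_mul, map_zsmul]
    rfl
  have htele : ∀ (n : ℕ) (f : Fin (n + 1) → Real.Angle),
      ∑ i : Fin n, (f i.succ - f i.castSucc) = f (Fin.last n) - f 0 := by
    intro n f
    rw [Finset.sum_sub_distrib, sub_eq_sub_iff_add_eq_add, add_comm, ← Fin.sum_univ_succ,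
      Fin.sum_univ_castSucc, add_comm]
  have hvert : ∀ v, ∑ e, C e * ((if D.tgt e = v then 1 else 0) - (if D.src e = v then 1 else 0)) =
      0 := by
    intro v
    by_cases hv : v ∈ G.support
    · exact congrFun hC ⟨v, hv⟩
    · refine Finset.sum_eq_zero fun e _ => ?_
      have h := D.adj_src_tgt e
      rw [if_neg (by rintro rfl; exact hv ⟨_, h.symm⟩), if_neg (by rintro rfl; exact hv ⟨_, h⟩)]
      simp
  rw [hsum, Fintype.sum_sigma]
  have hedge : ∀ e, ∑ i, C e • (g ((D.arc e).pt (Fin.succ i)) - g ((D.arc e).pt i.castSucc)) =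
      ∑ v, (C e * ((if D.tgt e = v then 1 else 0) - (if D.src e = v then 1 else 0))) •
        g (D.pos v) := by
    intro e
    rw [← Finset.smul_sum, htele _ fun k => g ((D.arc e).pt k), ← D.pos_tgt, ← D.pos_src]
    simp only [mul_smul, ← Finset.smul_sum, sub_smul, ite_smul, one_smul, zero_smul,
      Finset.sum_sub_distrib, Finset.sum_ite_eq, Finset.mem_univ, if_true]
  simp only [hedge]
  rw [Finset.sum_comm]
  simp only [← Finset.sum_smul, hvert, zero_smul, Finset.sum_const_zero]

/-- The side value at a directed edge, as a linear function of the weights. -/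
noncomputable def sideMap (x : G.edgeSet × Bool) : (G.edgeSet → ℤ) →ₗ[ℤ] ℝ where
  toFun C := D.segments.side (fun s => C s.1) (D.firstSegment x.1, x.2)
  map_add' C C' := by
    simp only [SegmentSystem.side, SegmentSystem.argSum, Pi.add_apply, Int.cast_add, add_mul,
      Finset.sum_add_distrib]
    split_ifs <;> ring
  map_smul' m C := by
    simp only [SegmentSystem.side, SegmentSystem.argSum, Pi.smul_apply, smul_eq_mul, Int.cast_mul,
      mul_assoc, ← Finset.mul_sum, zsmul_eq_mul, RingHom.id_apply]
    split_ifs <;> ring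

/-- The jump across an edge recovers its weight, so a cycle with all side values zero vanishes. -/
theorem sideMap_true_sub_false (e : G.edgeSet) (C : G.edgeSet → ℤ) :
    D.sideMap (e, true) C - D.sideMap (e, false) C = 2 * Real.pi * C e := by
  simp [sideMap, SegmentSystem.side, firstSegment]

theorem exists_sideMap_eq [Fintype V] {C : G.edgeSet → ℤ} (hC : D.boundary C = 0)
    (x : G.edgeSet × Bool) : ∃ n : ℤ, D.sideMap x C = 2 * Real.pi * n := by
  have hmid := midpoint_mem_openSegment (𝕜 := ℝ) (D.segments.a (D.firstSegment x.1))
    (D.segments.b (D.firstSegment x.1))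
  obtain ⟨n, hn⟩ := D.isCycle_of_boundary_eq_zero hC _
    fun t => SegmentSystem.ends_ne_of_mem_openSegment hmid t
  refine ⟨n - if x.2 then 0 else C x.1, ?_⟩
  simp only [sideMap, LinearMap.coe_mk, AddHom.coe_mk, SegmentSystem.side, hn]
  split_ifs
  · simp
  · push_cast
    rw [mul_sub]
    rfl

/-- Two directed edges have the same left side with respect to all cycles. -/
def sideSetoid : Setoid (G.edgeSet × Bool) where
  r x y := ∀ C, D.boundary C = 0 → D.sideMap x C = D.sideMap y C
  iseqv := ⟨fun _ _ _ => rfl, fun h C hC => (h C hC).symm,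
    fun h h' C hC => (h C hC).trans (h' C hC)⟩

/-- There are at least as many classes of sides as there are independent cycles. -/
theorem card_edgeSet_le_card_support_add_card_quotient [Fintype V] :
    Nat.card G.edgeSet ≤ G.support.ncard + Nat.card (Quotient D.sideSetoid) := by
  classical
  have : Fintype (Quotient D.sideSetoid) := Fintype.ofFinite _
  let Z := LinearMap.ker D.boundary
  have hrank : Module.finrank ℤ (LinearMap.range D.boundary) + Module.finrank ℤ Z =
      Module.finrank ℤ (G.edgeSet → ℤ) := finrank_range_add_finrank_ker_int _
  -- The exact rank is smaller by one per component, but this crude bound suffices and avoids any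
  -- discussion of connectedness.
  have hrange : Module.finrank ℤ (LinearMap.range D.boundary) ≤ G.support.ncard := by
    have := Submodule.finrank_le (LinearMap.range D.boundary)
    rwa [Module.finrank_fintype_fun_eq_card, ← Nat.card_eq_fintype_card] at this
  have hint : ∀ (C : Z) (q : Quotient D.sideSetoid), ∃ n : ℤ,
      D.sideMap q.out C = 2 * Real.pi * n := fun C q => D.exists_sideMap_eq C.2 _
  choose φ hφ using hint
  have hcancel : ∀ m n : ℤ, 2 * Real.pi * (m : ℝ) = 2 * Real.pi * n → m = n := fun m n h => by
    exact_mod_cast mul_left_cancel₀ Real.two_pi_pos.ne' h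
  -- A cycle is sent to its winding numbers, one for each class.
  let Φ : Z →ₗ[ℤ] (Quotient D.sideSetoid → ℤ) :=
    { toFun := φ
      map_add' := fun C C' => funext fun q => hcancel _ _ (by
        have h := hφ (C + C') q
        rw [Submodule.coe_add, map_add, hφ, hφ] at h
        rw [← h, Pi.add_apply]
        push_cast
        ring)
      map_smul' := fun m C => funext fun q => hcancel _ _ (by
        have h := hφ (m • C) q
        rw [Submodule.coe_smul, map_smul, hφ] at h
        rw [← h]
        simp
        ring) }
  have hinj : Function.Injective Φ := by
    rw [injective_iff_map_eq_zero]
    intro C hC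
    have hzero : ∀ x, D.sideMap x C = 0 := fun x => by
      have h1 : D.sideMap (Quotient.mk D.sideSetoid x).out C = D.sideMap x C :=
        Quotient.mk_out (s := D.sideSetoid) x C C.2
      rw [← h1, hφ, show φ C _ = 0 from congrFun hC _]
      simp
    refine Subtype.ext (funext fun e => hcancel _ _ ?_)
    rw [← D.sideMap_true_sub_false e C, hzero, hzero]
    simp
  have hZ := LinearMap.finrank_le_finrank_of_injective hinj
  rw [Module.finrank_fintype_fun_eq_card] at hrank hZ
  rw [Nat.card_eq_fintype_card, Nat.card_eq_fintype_card]
  omega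

/-- If the graph is bipartite and has no pendant edges, then all classes of sides have at least
four members. -/
theorem four_mul_card_quotient_le [Fintype V] (col : V → Bool)
    (hcol : ∀ v w, G.Adj v w → col v ≠ col w)
    (hdeg : ∀ (v : V) (e : G.edgeSet), v ∈ (e : Sym2 V) →
      ∃ f : G.edgeSet, f ≠ e ∧ v ∈ (f : Sym2 V)) :
    4 * Nat.card (Quotient D.sideSetoid) ≤ 2 * Nat.card G.edgeSet := by
  classical
  have : Fintype (Quotient D.sideSetoid) := Fintype.ofFinite _
  have hnext : ∀ x : G.edgeSet × Bool, ∃ y : G.edgeSet × Bool, y.1 ≠ x.1 ∧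
      D.dartTail y = D.dartHead x ∧ D.sideSetoid y x := fun x => by
    obtain ⟨y, h1, h2, h3⟩ := D.exists_next_dart x (hdeg _ _ (by
      rw [D.edge_eq_dart x]; exact Sym2.mem_mk_right _ _))
    exact ⟨y, h1, h2, fun C hC => h3 _ (D.isCycle_of_boundary_eq_zero hC)⟩
  choose nx hne htail hrel using hnext
  have hflip : ∀ x, col (D.dartTail (nx x)) ≠ col (D.dartTail x) := fun x => by
    rw [htail]
    have := x.1.2
    rw [D.edge_eq_dart x] at this
    exact (hcol _ _ this).symm
  -- A return after two steps would give two different edges with the same ends.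
  have h2 : ∀ x, nx (nx x) ≠ x := fun x h => by
    apply hne x
    apply Subtype.ext
    rw [D.edge_eq_dart, D.edge_eq_dart x, htail x, ← htail (nx x), h]
    exact Sym2.eq_swap
  have h1 : ∀ x, nx x ≠ x := fun x h => hne x (congrArg Prod.fst h)
  -- Each step changes the side of the bipartition, so no odd number of steps returns.
  have h3 : ∀ x, nx (nx (nx x)) ≠ x := fun x h => by
    have a := hflip x
    have b := hflip (nx x)
    have c := hflip (nx (nx x))
    rw [h] at c
    revert a b c
    generalize col (D.dartTail x) = i
    generalize col (D.dartTail (nx x)) = j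
    generalize col (D.dartTail (nx (nx x))) = k
    decide +revert
  have hfib : ∀ q ∈ (Finset.univ : Finset (Quotient D.sideSetoid)),
      4 ≤ (Finset.univ.filter fun x : G.edgeSet × Bool =>
        Quotient.mk D.sideSetoid x = q).card := by
    intro q _
    induction q using Quotient.ind with
    | _ x =>
    have hsub : ({x, nx x, nx (nx x), nx (nx (nx x))} : Finset (G.edgeSet × Bool)) ⊆
        Finset.univ.filter fun y : G.edgeSet × Bool =>
          Quotient.mk D.sideSetoid y = Quotient.mk D.sideSetoid x := by
      have r : ∀ y, Quotient.mk D.sideSetoid (nx y) = Quotient.mk D.sideSetoid y :=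
        fun y => Quotient.sound (hrel y)
      intro y hy
      simp only [Finset.mem_insert, Finset.mem_singleton] at hy
      rw [Finset.mem_filter]
      rcases hy with rfl | rfl | rfl | rfl <;> simp only [Finset.mem_univ, r, true_and]
    refine le_trans (le_of_eq ?_) (Finset.card_le_card hsub)
    rw [Finset.card_insert_of_notMem, Finset.card_insert_of_notMem, Finset.card_pair]
    · exact (h1 _).symm
    · simp only [Finset.mem_insert, Finset.mem_singleton, not_or]
      exact ⟨(h1 _).symm, (h2 _).symm⟩
    · simp only [Finset.mem_insert, Finset.mem_singleton, not_or]
      exact ⟨(h1 _).symm, (h2 _).symm, (h3 _).symm⟩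
  have hcard := Finset.card_nsmul_le_sum _ _ 4 hfib
  rw [← Finset.card_eq_sum_card_fiberwise (fun _ _ => Finset.mem_coe.2 (Finset.mem_univ _))] at hcard
  simp only [Finset.card_univ, Fintype.card_prod, Fintype.card_bool, smul_eq_mul] at hcard
  rw [Nat.card_eq_fintype_card, Nat.card_eq_fintype_card]
  omega

end PlaneDrawing

/-- A bipartite planar graph has at most twice as many edges as non-isolated vertices. -/
theorem IsPlanar.ncard_edgeSet_le_of_bipartite {V : Type u} [Finite V] (col : V → Bool) :
    ∀ (G : SimpleGraph V), G.IsPlanar → (∀ v w, G.Adj v w → col v ≠ col w) →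
      G.edgeSet.ncard ≤ 2 * G.support.ncard := by
  classical
  cases nonempty_fintype V
  intro G
  induction hn : G.edgeSet.ncard using Nat.strong_induction_on generalizing G with
  | _ n ih =>
  rintro ⟨D⟩ hcol
  by_cases hdeg : ∀ (v : V) (e : G.edgeSet), v ∈ (e : Sym2 V) →
      ∃ f : G.edgeSet, f ≠ e ∧ v ∈ (f : Sym2 V)
  -- From `m ≤ n + q` and `4q ≤ 2m` follows `m ≤ 2n`.
  · have h1 := D.card_edgeSet_le_card_support_add_card_quotient
    have h2 := D.four_mul_card_quotient_le col hcol hdeg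
    rw [Nat.card_coe_set_eq] at h1 h2
    omega
  -- Deleting a pendant edge costs one edge and isolates its end `v`, so the bound for the smaller
  -- graph is more than enough.
  · push Not at hdeg
    obtain ⟨v, e, hve, huniq⟩ := hdeg
    have hle : G.deleteEdges {(e : Sym2 V)} ≤ G := deleteEdges_le _
    have hcard : (G.deleteEdges {(e : Sym2 V)}).edgeSet.ncard + 1 = G.edgeSet.ncard := by
      rw [edgeSet_deleteEdges]
      exact Set.ncard_sdiff_singleton_add_one e.2
    have hsupp : (G.deleteEdges {(e : Sym2 V)}).support.ncard < G.support.ncard := by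
      refine Set.ncard_lt_ncard (Set.ssubset_iff_of_subset (support_mono hle) |>.2 ⟨v, ?_, ?_⟩)
      · have he := e.2
        obtain ⟨w, hw⟩ := Sym2.mem_iff_exists.1 hve
        rw [hw] at he
        exact ⟨w, he⟩
      · rintro ⟨w, hw⟩
        replace hw := deleteEdges_adj.1 hw
        exact huniq ⟨s(v, w), hw.1⟩ (fun h => hw.2 (congrArg Subtype.val h))
          (Sym2.mem_mk_left v w)
    have := ih _ (by omega) (G.deleteEdges {(e : Sym2 V)}) rfl ⟨D.restrict hle⟩
      fun a b h => hcol a b (hle h)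
    omega

end SimpleGraph

namespace SimpleGraph

/-! ### List colouring of bipartite graphs by kernels -/

/-- A finite digraph whose arcs join the two parts of a bipartition has a kernel. -/
theorem exists_kernel_of_bipartite {V : Type u} (col : V → Bool) (out : V → V → Prop)
    (hout : ∀ v w, out v w → col v ≠ col w) (X : Finset V) :
    ∃ K ⊆ X, (∀ v ∈ K, ∀ w ∈ K, ¬ out v w) ∧ ∀ v ∈ X, v ∉ K → ∃ w ∈ K, out v w := by
  classical
  induction X using Finset.strongInduction with
  | H X ih =>
    -- A sink joins the kernel and absorbs its in-neighbours; induction handles the rest. Without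
    -- sinks every vertex has an out-neighbour in the opposite part, so one whole part is a kernel.
    by_cases hsink : ∃ x ∈ X, ∀ w ∈ X, ¬ out x w
    · obtain ⟨x, hx, hxout⟩ := hsink
      let Y := X.filter fun w => w ≠ x ∧ ¬ out w x
      have hYX : Y ⊆ X := Finset.filter_subset _ _
      have hxY : x ∉ Y := by simp [Y]
      obtain ⟨K, hKY, hind, habs⟩ := ih Y (Finset.ssubset_iff_subset_ne.2
        ⟨hYX, fun h => hxY (h ▸ hx)⟩)
      have hKx : ∀ w ∈ K, ¬ out w x := fun w hw => (Finset.mem_filter.1 (hKY hw)).2.2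
      refine ⟨insert x K, Finset.insert_subset hx (hKY.trans hYX), ?_, ?_⟩
      · intro v hv w hw
        rcases Finset.mem_insert.1 hv with rfl | hv'
        · exact hxout w (Finset.insert_subset hx (hKY.trans hYX) hw)
        · rcases Finset.mem_insert.1 hw with rfl | hw'
          · exact hKx v hv'
          · exact hind v hv' w hw'
      · intro v hv hvK
        rw [Finset.mem_insert, not_or] at hvK
        by_cases hvx : out v x
        · exact ⟨x, Finset.mem_insert_self _ _, hvx⟩
        · obtain ⟨w, hw, h⟩ := habs v (Finset.mem_filter.2 ⟨hv, hvK.1, hvx⟩) hvK.2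
          exact ⟨w, Finset.mem_insert_of_mem hw, h⟩
    · push Not at hsink
      refine ⟨X.filter fun v => col v = true, Finset.filter_subset _ _, ?_, ?_⟩
      · intro v hv w hw h
        exact hout v w h ((Finset.mem_filter.1 hv).2.trans (Finset.mem_filter.1 hw).2.symm)
      · intro v hv hvK
        obtain ⟨w, hw, h⟩ := hsink v hv
        refine ⟨w, Finset.mem_filter.2 ⟨hw, ?_⟩, h⟩
        have h1 := hout v w h
        have h2 : col v ≠ true := fun h => hvK (Finset.mem_filter.2 ⟨hv, h⟩)
        revert h1 h2
        cases col v <;> cases col w <;> simp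

/-- A bipartite digraph can be coloured from lists which are longer than the out-degrees. -/
theorem exists_listColoring_of_outdegree_lt {V : Type u} {α : Type w} [Nonempty α]
    (col : V → Bool) (out : V → V → Prop) [∀ v, DecidablePred (out v)]
    (hout : ∀ v w, out v w → col v ≠ col w) (X : Finset V) (L : V → Finset α)
    (hL : ∀ v ∈ X, (X.filter (out v)).card < (L v).card) :
    ∃ f : V → α, (∀ v ∈ X, f v ∈ L v) ∧ ∀ v ∈ X, ∀ w ∈ X, out v w → f v ≠ f w := by
  classical
  induction X using Finset.strongInduction generalizing L with
  | H X ih =>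
    rcases X.eq_empty_or_nonempty with rfl | ⟨x, hx⟩
    · exact ⟨fun _ => Classical.arbitrary α, by simp, by simp⟩
    obtain ⟨c, hc⟩ := Finset.card_pos.1 ((Nat.zero_le _).trans_lt (hL x hx))
    obtain ⟨K, hKY, hind, habs⟩ :=
      exists_kernel_of_bipartite col out hout (X.filter fun v => c ∈ L v)
    have hKX : K ⊆ X := hKY.trans (Finset.filter_subset _ _)
    have hKne : K.Nonempty := by
      by_cases hxK : x ∈ K
      · exact ⟨x, hxK⟩
      · obtain ⟨w, hw, -⟩ := habs x (Finset.mem_filter.2 ⟨hx, hc⟩) hxK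
        exact ⟨w, hw⟩
    obtain ⟨f, hf1, hf2⟩ := ih (X \ K) (Finset.sdiff_ssubset hKX hKne)
      (fun v => (L v).erase c) (by
        intro v hv
        obtain ⟨hvX, hvK⟩ := Finset.mem_sdiff.1 hv
        have hsub : (X \ K).filter (out v) ⊆ X.filter (out v) :=
          Finset.filter_subset_filter _ Finset.sdiff_subset
        by_cases hcv : c ∈ L v
        · obtain ⟨w, hw, hvw⟩ := habs v (Finset.mem_filter.2 ⟨hvX, hcv⟩) hvK
          have hlt : ((X \ K).filter (out v)).card < (X.filter (out v)).card := by
            refine Finset.card_lt_card (Finset.ssubset_iff_subset_ne.2 ⟨hsub, fun h => ?_⟩)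
            have : w ∈ (X \ K).filter (out v) := h ▸ Finset.mem_filter.2 ⟨hKX hw, hvw⟩
            exact (Finset.mem_sdiff.1 (Finset.mem_filter.1 this).1).2 hw
          rw [Finset.card_erase_of_mem hcv]
          have := hL v hvX
          omega
        · rw [Finset.erase_eq_of_notMem hcv]
          exact (Finset.card_le_card hsub).trans_lt (hL v hvX))
    refine ⟨fun v => if v ∈ K then c else f v, ?_, ?_⟩
    · intro v hv
      by_cases hvK : v ∈ K
      · simpa [hvK] using (Finset.mem_filter.1 (hKY hvK)).2
      · simpa [hvK] using Finset.mem_of_mem_erase (hf1 v (Finset.mem_sdiff.2 ⟨hv, hvK⟩))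
    · intro v hv w hw hvw
      by_cases hvK : v ∈ K <;> by_cases hwK : w ∈ K
      · exact absurd hvw (hind v hvK w hwK)
      · simpa [hvK, hwK] using
          (Finset.ne_of_mem_erase (hf1 w (Finset.mem_sdiff.2 ⟨hw, hwK⟩))).symm
      · simpa [hvK, hwK] using Finset.ne_of_mem_erase (hf1 v (Finset.mem_sdiff.2 ⟨hv, hvK⟩))
      · simpa [hvK, hwK] using hf2 v (Finset.mem_sdiff.2 ⟨hv, hvK⟩) w
          (Finset.mem_sdiff.2 ⟨hw, hwK⟩) hvw

/-- If every set of edges has at most twice as many members as it has ends, then the edges can be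
assigned to their ends, at most two to each vertex. -/
theorem exists_two_orientation {V : Type u} [Fintype V] [DecidableEq V] (G : SimpleGraph V)
    (hG : ∀ A : Finset G.edgeSet,
      A.card ≤ 2 * (Finset.univ.filter fun v : V => ∃ e ∈ A, v ∈ (e : Sym2 V)).card) :
    ∃ o : G.edgeSet → V × Bool, Function.Injective o ∧ ∀ e : G.edgeSet, (o e).1 ∈ (e : Sym2 V) := by
  classical
  -- Hall's theorem, with every vertex doubled into two slots.
  have := (Finset.all_card_le_biUnion_card_iff_exists_injective
    (fun e : G.edgeSet => Finset.univ.filter fun x : V × Bool => x.1 ∈ (e : Sym2 V))).1 (by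
      intro A
      refine (hG A).trans (le_of_eq ?_)
      have : (A.biUnion fun e : G.edgeSet =>
          Finset.univ.filter fun x : V × Bool => x.1 ∈ (e : Sym2 V)) =
          (Finset.univ.filter fun v : V => ∃ e ∈ A, v ∈ (e : Sym2 V)) ×ˢ Finset.univ := by
        ext x
        simp
      rw [this, Finset.card_product, mul_comm]
      simp)
  obtain ⟨o, ho, h⟩ := this
  exact ⟨o, ho, fun e => by simpa using h e⟩

/-- A bipartite graph whose edge sets are sparse is 3-choosable. -/
theorem listColorable_of_bipartite_of_sparse {V : Type u} [Finite V] {α : Type w}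
    (G : SimpleGraph V) (col : V → Bool) (hcol : ∀ v w, G.Adj v w → col v ≠ col w)
    (hG : ∀ A : Set (Sym2 V), A ⊆ G.edgeSet → A.ncard ≤ 2 * {v : V | ∃ e ∈ A, v ∈ e}.ncard)
    (L : V → Finset α) (hL : ∀ v, (L v).card = 3) : G.ListColorable L := by
  classical
  cases nonempty_fintype V
  rcases isEmpty_or_nonempty V with hV | ⟨⟨v₀⟩⟩
  · exact ⟨fun v => hV.elim v, fun v => hV.elim v, fun v => hV.elim v⟩
  obtain ⟨a₀, -⟩ : (L v₀).Nonempty := by rw [← Finset.card_pos, hL]; norm_num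
  have : Nonempty α := ⟨a₀⟩
  obtain ⟨o, hinj, ho⟩ := exists_two_orientation G (by
    intro A
    have := hG (Subtype.val '' (A : Set G.edgeSet)) (by rintro _ ⟨e, -, rfl⟩; exact e.2)
    rw [Set.ncard_image_of_injective _ Subtype.val_injective, Set.ncard_coe_finset] at this
    rw [← Set.ncard_coe_finset (Finset.univ.filter _)]
    convert this using 4
    simp)
  -- Each edge leaves the vertex to which it is assigned; two slots per vertex make all out-degrees
  -- at most 2.
  let out : V → V → Prop := fun v w => ∃ h : G.Adj v w, (o ⟨s(v, w), h⟩).1 = v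
  obtain ⟨f, hf1, hf2⟩ := exists_listColoring_of_outdegree_lt col out
    (fun v w h => hcol v w h.1) Finset.univ L (by
      intro v _
      rw [hL]
      have : (Finset.univ.filter (out v)).card ≤ (Finset.univ : Finset Bool).card := by
        refine Finset.card_le_card_of_injOn
          (fun w => if h : G.Adj v w then (o ⟨s(v, w), h⟩).2 else true) (fun _ _ => Finset.mem_coe.2 (Finset.mem_univ _)) ?_
        intro x hx y hy hxy
        obtain ⟨hvx, hx⟩ := (Finset.mem_filter.1 hx).2
        obtain ⟨hvy, hy⟩ := (Finset.mem_filter.1 hy).2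
        simp only [hvx, hvy, dite_true] at hxy
        have := hinj (Prod.ext (hx.trans hy.symm) hxy)
        exact Sym2.congr_right.1 (congrArg Subtype.val this)
      simp at this
      omega)
  refine ⟨f, fun v => hf1 v (Finset.mem_univ v), fun v w hvw => ?_⟩
  rcases Sym2.mem_iff.1 (ho ⟨s(v, w), hvw⟩) with h | h
  · exact hf2 v (Finset.mem_univ _) w (Finset.mem_univ _) ⟨hvw, h⟩
  · refine (hf2 w (Finset.mem_univ _) v (Finset.mem_univ _) ⟨hvw.symm, ?_⟩).symm
    have he : (⟨s(w, v), hvw.symm⟩ : G.edgeSet) = ⟨s(v, w), hvw⟩ := Subtype.ext Sym2.eq_swap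
    exact (congrArg (fun e => (o e).1) he).trans h

/-- The part of a `{1, 3}`-assignment that lies in the two colour groups. -/
theorem IsPartitionAssignment.exists_groups {V : Type u} {α : Type w} {L : V → Finset α}
    (h : IsPartitionAssignment partitionOneThree L) :
    ∃ C D : Set α, Disjoint C D ∧ ∀ v, ((L v : Set α) ∩ C).ncard = 1 ∧
      ((L v : Set α) ∩ D).ncard = 3 := by
  obtain ⟨-, q, k, C, hk, -, hdisj, hcard⟩ := h
  have h1 : 1 ∈ Multiset.map k Finset.univ.val := by rw [hk]; simp [partitionOneThree]
  have h3 : 3 ∈ Multiset.map k Finset.univ.val := by rw [hk]; simp [partitionOneThree]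
  obtain ⟨i, -, hi⟩ := Multiset.mem_map.1 h1
  obtain ⟨j, -, hj⟩ := Multiset.mem_map.1 h3
  refine ⟨C i, C j, hdisj i j (by rintro rfl; omega), fun v => ⟨?_, ?_⟩⟩
  · rw [hcard, hi]
  · rw [hcard, hj]

/-- A 3-colourable graph is `{1, 3}`-choosable if its bipartite subgraphs are sparse. -/
theorem partitionChoosable_oneThree_of_sparse {V : Type u} [Finite V] (G : SimpleGraph V)
    (hG : G.Colorable 3)
    (hsparse : ∀ H ≤ G, ∀ col : V → Bool, (∀ v w, H.Adj v w → col v ≠ col w) →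
      H.edgeSet.ncard ≤ 2 * H.support.ncard) :
    PartitionChoosable.{u, w} G partitionOneThree := by
  classical
  intro α L hL
  obtain ⟨κ⟩ := hG
  obtain ⟨C, D, hCD, hLCD⟩ := hL.exists_groups
  -- The graph spanned by the classes 1 and 2, kept on all of `V` with class 0 isolated.
  let H : SimpleGraph V :=
    { Adj := fun v w => G.Adj v w ∧ κ v ≠ 0 ∧ κ w ≠ 0
      symm := ⟨fun v w h => ⟨h.1.symm, h.2.2, h.2.1⟩⟩
      loopless := ⟨fun v h => G.loopless.irrefl v h.1⟩ }
  have hcol : ∀ v w, H.Adj v w → decide (κ v = 1) ≠ decide (κ w = 1) := by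
    rintro v w ⟨hvw, hv, hw⟩ h
    have hne := κ.valid hvw
    rw [decide_eq_decide] at h
    revert hne hv hw h
    generalize κ v = x
    generalize κ w = y
    decide +revert
  have hcard : ∀ v, ((L v).filter (· ∈ D)).card = 3 := fun v => by
    rw [← (hLCD v).2, ← Set.ncard_coe_finset]
    congr 1
    ext x
    simp
  obtain ⟨f, hf1, hf2⟩ := listColorable_of_bipartite_of_sparse H _ hcol (by
    intro A hA
    -- Hall's condition concerns arbitrary edge sets; each is the edge set of a subgraph, whose
    -- support consists of the ends of these edges.
    have hle : fromEdgeSet A ≤ H := by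
      intro v w h
      rw [fromEdgeSet_adj] at h
      exact hA h.1
    have := hsparse (fromEdgeSet A) (hle.trans fun v w h => h.1) _ fun v w h => hcol v w (hle h)
    have hE : (fromEdgeSet A).edgeSet = A := by
      rw [edgeSet_fromEdgeSet, sdiff_eq_left, Set.disjoint_left]
      exact fun e he hd => H.not_isDiag_of_mem_edgeSet (hA he) hd
    have hS : (fromEdgeSet A).support = {v : V | ∃ e ∈ A, v ∈ e} := by
      ext v
      rw [mem_support]
      constructor
      · rintro ⟨w, h⟩
        exact ⟨s(v, w), ((fromEdgeSet_adj _).1 h).1, Sym2.mem_mk_left v w⟩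
      · rintro ⟨e, he, hv⟩
        obtain ⟨w, rfl⟩ := Sym2.mem_iff_exists.1 hv
        exact ⟨w, (fromEdgeSet_adj _).2 ⟨he, G.ne_of_adj (H.mem_edgeSet.1 (hA he)).1⟩⟩
    rwa [hE, hS] at this) _ hcard
  have hone : ∀ v, ∃ x, x ∈ L v ∧ x ∈ C := fun v => by
    obtain ⟨x, hx⟩ := Set.ncard_eq_one.1 (hLCD v).1
    have : x ∈ (L v : Set α) ∩ C := hx ▸ Set.mem_singleton x
    exact ⟨x, by simpa using this.1, this.2⟩
  choose g hgL hgC using hone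
  have hfL : ∀ v, f v ∈ L v ∧ f v ∈ D := fun v => by simpa using hf1 v
  refine ⟨fun v => if κ v = 0 then g v else f v, fun v => ?_, fun v w hvw => ?_⟩
  · dsimp only
    split_ifs
    exacts [hgL v, (hfL v).1]
  · by_cases hv : κ v = 0 <;> by_cases hw : κ w = 0
    · exact absurd (hv.trans hw.symm) (κ.valid hvw)
    · simpa [hv, hw] using hCD.ne_of_mem (hgC v) (hfL w).2
    · simpa [hv, hw] using (hCD.ne_of_mem (hgC w) (hfL v).2).symm
    · simpa [hv, hw] using hf2 v w ⟨hvw, hv, hw⟩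

end SimpleGraph

theorem mainTheorem7 {V : Type u} [Finite V] (G : SimpleGraph V) (hplanar : G.IsPlanar)
    (hchrom : G.chromaticNumber = 3) :
    SimpleGraph.PartitionChoosable.{u, w} G SimpleGraph.partitionOneThree := by
  obtain ⟨D⟩ := hplanar
  refine SimpleGraph.partitionChoosable_oneThree_of_sparse G
    (SimpleGraph.chromaticNumber_le_iff_colorable.1 hchrom.le) fun H hH col hcol => ?_
  exact SimpleGraph.IsPlanar.ncard_edgeSet_le_of_bipartite col H ⟨D.restrict hH⟩ hcol
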